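/- There exist a numerical constant $c>0$ and, for every integer $n\ge 1$, a constant $c_n>0$ depending only on $n$, such that the following holds. Let $w$ be a strong Muckenhoupt weight on $\mathbb{R}^n$, i.e. a non-negative locally integrable function $w$ with $[w]_{A_\infty^*}<\infty$, where $$[w]_{A_\infty^*}:=\sup_{1\le j\le n}\ \operatorname*{ess\,sup}_{\bar x^j\in\mathbb{R}^{n-1}}\ [w_{\bar x^j}]_{A_\infty},\qquad \bar x^j:=(x_1,\dots,x_{j-1},x_{j+1},\dots,x_n),\quad w_{\bar x^j}(t):=w(x_1,\dots,x_{j-1},t,x_{j+1},\dots,x_n)\quad(t\in\mathbb{R}),$$ and, for a weight $v$ on the real line, $$[v]_{A_\infty}:=\sup_I \frac{1}{v(I)}\int_I M(v\mathbf 1_I)(x)\,dx,\qquad Mf(x):=\sup_{J\ni x}\frac1{|J|}\int_J|f|,$$ the suprema being over bounded intervals $I,J\subset\mathbb{R}$ of positive length (with the quotient read as $0$ when $v(I)=0$). Write $w(E):=\int_E w(x)\,dx$. Then for every bounded rectangular parallelepiped $R\subset\mathbb{R}^n$ with sides of positive length parallel to the coordinate axes, and every Lebesgue measurable set $E\subseteq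 R$, $$w(E)\le c_n\Big(\frac{|E|}{|R|}\Big)^{1/(c\,n\,[w]_{A_\infty^*})}\,w(R),$$ that is, $\dfrac{w(E)}{w(R)}\le c_n\Big(\dfrac{|E|}{|R|}\Big)^{1/(cn[w]_{A_\infty^*})}$ whenever $w(R)>0$. (If $w=0$ almost everywhere, so that $[w]_{A_\infty^*}=0$, both sides of the first inequality are read as $0$.) -/

import Mathlib

open MeasureTheory Set
open scoped ENNReal

noncomputable section

/-- The non-centered Hardy-Littlewood maximal function on the real line, with values in `[0, ∞]`:
the supremum of the averages of `|f|` over the bounded intervals containing `x`. -/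
def maximalFunction (f : ℝ → ℝ) (x : ℝ) : ℝ≥0∞ :=
  ⨆ (a : ℝ) (b : ℝ) (_ : a < x ∧ x < b),
    (∫⁻ y in Ioo a b, ENNReal.ofReal |f y|) / ENNReal.ofReal (b - a)

/-- The Fujii-Wilson constant of a weight `w` on the real line, with values in `[0, ∞]`:
the supremum over all bounded intervals `I` of `w(I)⁻¹ ∫_I M(w 1_I)`.
When `w(I) = 0` the quotient is `0 / 0 = 0`. -/
def ainftyConst (w : ℝ → ℝ) : ℝ≥0∞ :=
  ⨆ (a : ℝ) (b : ℝ) (_ : a < b),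
    (∫⁻ x in Ioo a b, maximalFunction ((Ioo a b).indicator w) x) /
      (∫⁻ x in Ioo a b, ENNReal.ofReal (w x))

/-- The one-dimensional slice of `w` in the `j`-th coordinate direction, the other coordinates
being given by `y`. -/
def slice {n : ℕ} (w : (Fin n → ℝ) → ℝ) (j : Fin n) (y : {i : Fin n // i ≠ j} → ℝ) (t : ℝ) : ℝ :=
  w (fun i => if h : i = j then t else y ⟨i, h⟩)

/-- The strong `A_∞` constant of a weight on `ℝⁿ`, with values in `[0, ∞]`: the supremum over the
coordinate directions `j`, and the essential supremum over the remaining `n - 1` coordinates, of the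
Fujii-Wilson constants of the slices. -/
def strongAinftyConst {n : ℕ} (w : (Fin n → ℝ) → ℝ) : ℝ≥0∞ :=
  ⨆ j : Fin n, essSup (fun y : {i : Fin n // i ≠ j} → ℝ => ainftyConst (slice w j y)) volume

/-- A weight: a non-negative locally integrable function on `ℝⁿ`. -/
structure IsWeight {n : ℕ} (w : (Fin n → ℝ) → ℝ) : Prop where
  nonneg : ∀ x, 0 ≤ w x
  locallyIntegrable : LocallyIntegrable w volume

/-- The strong Muckenhoupt class `A_∞^*`: weights with finite strong `A_∞` constant. -/
structure IsStrongAinfty {n : ℕ} (w : (Fin n → ℝ) → ℝ) : Prop where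
  isWeight : IsWeight w
  const_lt_top : strongAinftyConst w < ∞

/-- The closed axis-parallel rectangle with opposite vertices `a` and `b`. -/
def rectangle {n : ℕ} (a b : Fin n → ℝ) : Set (Fin n → ℝ) :=
  {x | ∀ i, a i ≤ x i ∧ x i ≤ b i}

end

/-!
On the line, let `ν = w dx` and let `E` have small density in an interval `I`. Replace `E` by the
union of the maximal dyadic subintervals in which its density exceeds `1 / 4`, and repeat. Each step
multiplies the Lebesgue measure by at most `4`. While the density in a maximal interval `J` stays
below `1 / 2`, the points added in `J` have `M(w 1_J) ≥ ν(J) / |J|` and fill at least half of `J`,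
so each step adds at least half of the new `ν`-measure to the integral of the maximal function.
Since that integral is at most `[w] ν(J)`, after about `4 [w]` steps the `ν`-measure has doubled.
Iterating, `ν(E) ≤ 2 ^ (-j) ν(I)` as long as `|E| / |I|` is less than `4 ^ (-4 [w] j) / 2`, which is
a power law with exponent comparable to `1 / [w]`.

In higher dimensions, split off one variable. By Chebyshev's inequality, the fibers of `E` of
density at least `l` are based on a set of density at most `|E| / (|R| l)`, to which the estimate in
the base applies, while the other fibers are controlled by the estimate in the fiber. The best `l`
makes the reciprocals of the exponents add up.
-/

open scoped NNReal

theorem measure_div_measure_le_one {X : Type*} [MeasurableSpace X] {μ : Measure X} {E R : Set X}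
    (hER : E ⊆ R) : μ E / μ R ≤ 1 :=
  ENNReal.div_le_of_le_mul (by simpa using measure_mono hER)

theorem measure_div_measure_rpow_ne_top {X : Type*} [MeasurableSpace X] {μ : Measure X}
    {E R : Set X} (hER : E ⊆ R) {s : ℝ} (hs : 0 ≤ s) : (μ E / μ R) ^ s ≠ ∞ :=
  ENNReal.rpow_ne_top_of_nonneg hs
    ((measure_div_measure_le_one hER).trans_lt ENNReal.one_lt_top).ne

theorem measure_setOf_le_fiber_div_le {X Y : Type*} [MeasurableSpace X] [MeasurableSpace Y]
    {μ : Measure X} {ν : Measure Y} [SFinite μ] [SFinite ν] {A : Set X} {B : Set Y}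
    {E : Set (X × Y)} (hE : MeasurableSet E) (hA₀ : μ A ≠ 0) (hA : μ A ≠ ∞) {l : ℝ≥0∞}
    (hl₀ : l ≠ 0) (hl : l ≠ ∞) :
    ν {y | l ≤ μ ((fun x => (x, y)) ⁻¹' E) / μ A} / ν B ≤
      μ.prod ν E / μ.prod ν (A ×ˢ B) / l := by
  have hfib : Measurable fun y => μ ((fun x => (x, y)) ⁻¹' E) := measurable_measure_prodMk_right hE
  calc ν {y | l ≤ μ ((fun x => (x, y)) ⁻¹' E) / μ A} / ν B
      ≤ (∫⁻ y, μ ((fun x => (x, y)) ⁻¹' E) / μ A ∂ν) / l / ν B := by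
        gcongr
        exact meas_ge_le_lintegral_div (hfib.div_const _).aemeasurable hl₀ hl
    _ = μ.prod ν E / μ.prod ν (A ×ˢ B) / l := by
        simp only [div_eq_mul_inv]
        rw [lintegral_mul_const _ hfib, Measure.prod_apply_symm hE, Measure.prod_prod,
          ENNReal.mul_inv (Or.inl hA₀) (Or.inl hA)]
        ring

/-- The quantitative absolute continuity `∫_E f ≤ C (μ E / μ R) ^ (1 / p) ∫_R f` of `f μ` with
respect to `μ` on the set `R`. The exponent is parametrized by its reciprocal because reciprocals
add up under products; `p = 0` encodes the exponent `0`. -/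
def HasAinftyBoundOn {X : Type*} [MeasurableSpace X] (μ : Measure X) (C : ℝ≥0) (p : ℝ)
    (f : X → ℝ≥0∞) (R : Set X) : Prop :=
  ∀ E, MeasurableSet E → E ⊆ R → ∫⁻ x in E, f x ∂μ ≤ C * (μ E / μ R) ^ p⁻¹ * ∫⁻ x in R, f x ∂μ

namespace HasAinftyBoundOn

section Basic

variable {X : Type*} [MeasurableSpace X] {μ : Measure X} {C : ℝ≥0} {p : ℝ} {f : X → ℝ≥0∞}
  {R : Set X}

theorem of_exponent_zero (hC : 1 ≤ C) : HasAinftyBoundOn μ C 0 f R := by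
  intro E _ hER
  rw [inv_zero, ENNReal.rpow_zero, mul_one]
  exact (lintegral_mono_set hER).trans (le_mul_of_one_le_left zero_le (by exact_mod_cast hC))

theorem of_lintegral_eq_zero (hf : ∫⁻ x in R, f x ∂μ = 0) : HasAinftyBoundOn μ C p f R :=
  fun _ _ hER => ((lintegral_mono_set hER).trans_eq hf).trans zero_le

theorem of_lintegral_eq_top (hC : C ≠ 0) (hp : 0 ≤ p) (hR : μ R ≠ ∞)
    (hf : ∫⁻ x in R, f x ∂μ = ∞) : HasAinftyBoundOn μ C p f R := by
  intro E _ _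
  rcases eq_or_ne (μ E) 0 with hE | hE
  · simp [setLIntegral_measure_zero _ _ hE]
  · have hratio : μ E / μ R ≠ 0 := (ENNReal.div_pos hE hR).ne'
    have hpow : (μ E / μ R) ^ p⁻¹ ≠ 0 := by
      simp [ENNReal.rpow_eq_zero_iff, hratio, (inv_nonneg.2 hp).not_gt]
    rw [hf, ENNReal.mul_top (mul_ne_zero (by exact_mod_cast hC) hpow)]
    exact le_top

theorem congr_set {R' : Set X} (h : HasAinftyBoundOn μ C p f R) (hR : MeasurableSet R)
    (hRR' : R =ᵐ[μ] R') : HasAinftyBoundOn μ C p f R' := by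
  intro E hE hER'
  have hEae : (E ∩ R : Set X) =ᵐ[μ] E := by
    simpa [inter_eq_left.2 hER'] using (ae_eq_refl E).inter hRR'
  rw [← setLIntegral_congr hEae, ← setLIntegral_congr hRR', ← measure_congr hEae,
    ← measure_congr hRR']
  exact h _ (hE.inter hR) inter_subset_right

theorem of_comp_measurableEquiv {Y : Type*} [MeasurableSpace Y] {ν : Measure Y} {g : Y → ℝ≥0∞}
    {S : Set Y} {e : X ≃ᵐ Y} (he : MeasurePreserving e μ ν)
    (h : HasAinftyBoundOn μ C p (fun x => g (e x)) (e ⁻¹' S)) : HasAinftyBoundOn ν C p g S := by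
  intro E hE hES
  have hpre := h (e ⁻¹' E) (e.measurable hE) (preimage_mono hES)
  rwa [he.setLIntegral_comp_preimage_emb e.measurableEmbedding,
    he.setLIntegral_comp_preimage_emb e.measurableEmbedding, he.measure_preimage_equiv,
    he.measure_preimage_equiv] at hpre

theorem setLIntegral_le_of_nullMeasurableSet (h : HasAinftyBoundOn μ C p f R) {E : Set X}
    (hE : NullMeasurableSet E μ) (hER : E ⊆ R) :
    ∫⁻ x in E, f x ∂μ ≤ C * (μ E / μ R) ^ p⁻¹ * ∫⁻ x in R, f x ∂μ := by
  obtain ⟨F, hFE, hF, hae⟩ := hE.exists_measurable_subset_ae_eq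
  rw [← setLIntegral_congr hae, ← measure_congr hae]
  exact h F hF (hFE.trans hER)

theorem setIntegral_le {w : X → ℝ} (hw : ∀ x, 0 ≤ w x) (hint : IntegrableOn w R μ) (hp : 0 ≤ p)
    (h : HasAinftyBoundOn μ C p (fun x => ENNReal.ofReal (w x)) R) {E : Set X}
    (hE : NullMeasurableSet E μ) (hER : E ⊆ R) :
    ∫ x in E, w x ∂μ ≤ C * (μ.real E / μ.real R) ^ p⁻¹ * ∫ x in R, w x ∂μ := by
  have hw' : ∀ S : Set X, 0 ≤ᵐ[μ.restrict S] w := fun _ => .of_forall hw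
  have hbound := h.setLIntegral_le_of_nullMeasurableSet hE hER
  rw [← ofReal_integral_eq_lintegral_ofReal (hint.mono_set hER) (hw' E),
    ← ofReal_integral_eq_lintegral_ofReal hint (hw' R)] at hbound
  have hfinite : C * (μ E / μ R) ^ p⁻¹ * ENNReal.ofReal (∫ x in R, w x ∂μ) ≠ ∞ :=
    ENNReal.mul_ne_top (ENNReal.mul_ne_top ENNReal.coe_ne_top
      (measure_div_measure_rpow_ne_top hER (inv_nonneg.2 hp)))
      ENNReal.ofReal_ne_top
  have hreal := ENNReal.toReal_mono hfinite hbound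
  rwa [ENNReal.toReal_ofReal (integral_nonneg hw), ENNReal.toReal_mul, ENNReal.toReal_mul,
    ← ENNReal.toReal_rpow, ENNReal.toReal_div, ENNReal.toReal_ofReal (integral_nonneg hw)] at hreal

end Basic

section Prod

variable {X Y : Type*} [MeasurableSpace X] [MeasurableSpace Y] {μ : Measure X} {ν : Measure Y}
  [SFinite μ] [SFinite ν] {f : X × Y → ℝ≥0∞} {C K : ℝ≥0} {p q : ℝ} {A : Set X} {B : Set Y}

theorem setLIntegral_le_of_fibers_le (hf : AEMeasurable f (μ.prod ν)) (hp : 0 ≤ p)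
    (hB : MeasurableSet B) (h : ∀ᵐ y ∂ν, HasAinftyBoundOn μ C p (fun x => f (x, y)) A)
    {E : Set (X × Y)} (hE : MeasurableSet E) (hEAB : E ⊆ A ×ˢ B) {l : ℝ≥0∞} (hl : l ≠ ∞)
    (hfib : ∀ y, μ ((fun x => (x, y)) ⁻¹' E) / μ A ≤ l) :
    ∫⁻ z in E, f z ∂μ.prod ν ≤ C * l ^ p⁻¹ * ∫⁻ z in A ×ˢ B, f z ∂μ.prod ν := by
  have hκ : C * l ^ p⁻¹ ≠ ∞ := ENNReal.mul_ne_top ENNReal.coe_ne_top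
    (ENNReal.rpow_ne_top_of_nonneg (inv_nonneg.2 hp) hl)
  have hsection : ∀ y, MeasurableSet ((fun x => (x, y)) ⁻¹' E) := fun _ =>
    measurable_prodMk_right hE
  calc ∫⁻ z in E, f z ∂μ.prod ν
      = ∫⁻ z in univ ×ˢ B, E.indicator f z ∂μ.prod ν := by
        rw [setLIntegral_indicator hE,
          inter_eq_left.2 (hEAB.trans (prod_mono_left (subset_univ A)))]
    _ = ∫⁻ y in B, ∫⁻ x in (fun x => (x, y)) ⁻¹' E, f (x, y) ∂μ ∂ν := by
        rw [setLIntegral_prod_symm _ (hf.indicator hE).restrict]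
        refine lintegral_congr fun y => ?_
        rw [Measure.restrict_univ, ← lintegral_indicator (hsection y)]
        rfl
    _ ≤ ∫⁻ y in B, C * l ^ p⁻¹ * ∫⁻ x in A, f (x, y) ∂μ ∂ν := by
        refine setLIntegral_mono_ae' hB (h.mono fun y hy _ => ?_)
        refine (hy _ (hsection y) fun x hx => (hEAB hx).1).trans ?_
        gcongr
        exact hfib y
    _ = C * l ^ p⁻¹ * ∫⁻ z in A ×ˢ B, f z ∂μ.prod ν := by
        rw [lintegral_const_mul' _ _ hκ, setLIntegral_prod_symm _ hf.restrict]

theorem setLIntegral_prod_le (hf : AEMeasurable f (μ.prod ν)) (hq : 0 ≤ q)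
    (h : ∀ᵐ x ∂μ, HasAinftyBoundOn ν K q (fun y => f (x, y)) B) {F : Set Y}
    (hF : MeasurableSet F) (hFB : F ⊆ B) :
    ∫⁻ z in A ×ˢ F, f z ∂μ.prod ν ≤
      K * (ν F / ν B) ^ q⁻¹ * ∫⁻ z in A ×ˢ B, f z ∂μ.prod ν := by
  have hκ : K * (ν F / ν B) ^ q⁻¹ ≠ ∞ :=
    ENNReal.mul_ne_top ENNReal.coe_ne_top (measure_div_measure_rpow_ne_top hFB (inv_nonneg.2 hq))
  rw [setLIntegral_prod _ hf.restrict, setLIntegral_prod _ hf.restrict,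
    ← lintegral_const_mul' _ _ hκ]
  exact lintegral_mono_ae (ae_restrict_of_ae (h.mono fun x hx => hx F hF hFB))

theorem setLIntegral_le_add_of_pos (hf : AEMeasurable f (μ.prod ν)) (hp : 0 ≤ p) (hq : 0 ≤ q)
    (hA₀ : μ A ≠ 0) (hA : μ A ≠ ∞) (hB : MeasurableSet B)
    (h₁ : ∀ᵐ y ∂ν, HasAinftyBoundOn μ C p (fun x => f (x, y)) A)
    (h₂ : ∀ᵐ x ∂μ, HasAinftyBoundOn ν K q (fun y => f (x, y)) B)
    {E : Set (X × Y)} (hE : MeasurableSet E) (hEAB : E ⊆ A ×ˢ B) {l : ℝ≥0∞} (hl₀ : l ≠ 0)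
    (hl : l ≠ ∞) :
    ∫⁻ z in E, f z ∂μ.prod ν ≤
      (C * l ^ p⁻¹ + K * (μ.prod ν E / μ.prod ν (A ×ˢ B) / l) ^ q⁻¹) *
        ∫⁻ z in A ×ˢ B, f z ∂μ.prod ν := by
  set dense : Set Y := {y | l ≤ μ ((fun x => (x, y)) ⁻¹' E) / μ A}
  have hdense : MeasurableSet dense :=
    measurableSet_le measurable_const ((measurable_measure_prodMk_right hE).div_const _)
  have hdenseE : MeasurableSet (Prod.snd ⁻¹' dense : Set (X × Y)) := measurable_snd hdense
  have hsparse : ∫⁻ z in E \ Prod.snd ⁻¹' dense, f z ∂μ.prod ν ≤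
      C * l ^ p⁻¹ * ∫⁻ z in A ×ˢ B, f z ∂μ.prod ν := by
    refine setLIntegral_le_of_fibers_le hf hp hB h₁ (hE.diff hdenseE)
      (sdiff_subset.trans hEAB) hl fun y => ?_
    by_cases hy : y ∈ dense
    · simp [preimage_sdiff, preimage_preimage, hy]
    · refine le_trans ?_ (not_le.1 hy).le
      gcongr
      exact sdiff_subset
  have hfull : ∫⁻ z in E ∩ Prod.snd ⁻¹' dense, f z ∂μ.prod ν ≤
      K * (μ.prod ν E / μ.prod ν (A ×ˢ B) / l) ^ q⁻¹ * ∫⁻ z in A ×ˢ B, f z ∂μ.prod ν := by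
    have hsub : E ∩ Prod.snd ⁻¹' dense ⊆ A ×ˢ (B ∩ dense) := fun z hz =>
      ⟨(hEAB hz.1).1, (hEAB hz.1).2, hz.2⟩
    refine (lintegral_mono_set hsub).trans ?_
    refine (setLIntegral_prod_le hf hq h₂ (hB.inter hdense) inter_subset_left).trans ?_
    gcongr K * ?_ ^ _ * _
    exact (ENNReal.div_le_div_right (measure_mono inter_subset_right) _).trans
      (measure_setOf_le_fiber_div_le hE hA₀ hA hl₀ hl)
  rw [← lintegral_inter_add_sdiff f E hdenseE, add_comm (C * l ^ p⁻¹), add_mul]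
  exact add_le_add hfull hsparse

protected theorem prod (hf : AEMeasurable f (μ.prod ν)) (hp : 0 < p) (hq : 0 < q)
    (hA₀ : μ A ≠ 0) (hA : μ A ≠ ∞) (hB : MeasurableSet B) (hB' : ν B ≠ ∞)
    (h₁ : ∀ᵐ y ∂ν, HasAinftyBoundOn μ C p (fun x => f (x, y)) A)
    (h₂ : ∀ᵐ x ∂μ, HasAinftyBoundOn ν K q (fun y => f (x, y)) B) :
    HasAinftyBoundOn (μ.prod ν) (C + K) (p + q) f (A ×ˢ B) := by
  intro E hE hEAB
  set m := μ.prod ν E / μ.prod ν (A ×ˢ B) with hm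
  rcases eq_or_ne (μ.prod ν E) 0 with hE₀ | hE₀
  · simp [setLIntegral_measure_zero _ _ hE₀]
  have hm₀ : m ≠ 0 :=
    (ENNReal.div_pos hE₀ (by rw [Measure.prod_prod]; exact ENNReal.mul_ne_top hA hB')).ne'
  have hm' : m ≠ ∞ := ((measure_div_measure_le_one hEAB).trans_lt ENNReal.one_lt_top).ne
  -- This density threshold makes the contributions of the dense and the sparse fibers equal.
  set l := m ^ (p / (p + q)) with hl
  have hsparse : l ^ p⁻¹ = m ^ (p + q)⁻¹ := by
    rw [hl, ← ENNReal.rpow_mul]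
    congr 1
    field_simp
  have hdense : (m / l) ^ q⁻¹ = m ^ (p + q)⁻¹ := by
    have hquot : m / l = m ^ (q / (p + q)) := by
      have hexp : q / (p + q) = 1 - p / (p + q) := by field_simp; ring
      rw [hexp, ENNReal.rpow_sub _ _ hm₀ hm', ENNReal.rpow_one]
    rw [hquot, ← ENNReal.rpow_mul]
    congr 1
    field_simp
  have hl₀ : l ≠ 0 := (ENNReal.rpow_pos (pos_iff_ne_zero.2 hm₀) hm').ne'
  have hl' : l ≠ ∞ := ENNReal.rpow_ne_top_of_nonneg (by positivity) hm'
  have hbound := setLIntegral_le_add_of_pos hf hp.le hq.le hA₀ hA hB h₁ h₂ hE hEAB hl₀ hl'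
  rw [← hm, hsparse, hdense, ← add_mul] at hbound
  exact_mod_cast hbound

end Prod

end HasAinftyBoundOn

/-- A finite binary tree. Over an interval `(a, b]` it encodes a finite union of dyadic
subintervals: the children of a node live over the two halves of the interval of the node. -/
inductive DyadicTree : Type
  | empty : DyadicTree
  | full : DyadicTree
  | node : DyadicTree → DyadicTree → DyadicTree

namespace DyadicTree

/-- The subset of `(a, b]` encoded by a tree. -/
def toSet : DyadicTree → ℝ → ℝ → Set ℝ
  | empty, _, _ => ∅
  | full, a, b => Ioc a b
  | node l r, a, b => l.toSet a ((a + b) / 2) ∪ r.toSet ((a + b) / 2) b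

/-- The proportion of `(a, b]` covered by the set encoded by a tree. -/
noncomputable def density : DyadicTree → ℝ
  | empty => 0
  | full => 1
  | node l r => (l.density + r.density) / 2

open Classical in
/-- The union of the maximal dyadic intervals in which a tree has density greater than `1 / 4`: a
discrete level set of the maximal function of its indicator. -/
noncomputable def enlarge : DyadicTree → DyadicTree
  | empty => empty
  | full => full
  | node l r => if 1 / 4 < (node l r).density then full else node l.enlarge r.enlarge

section Density

variable (T : DyadicTree)

theorem density_nonneg : 0 ≤ T.density := by
  induction T with
  | empty => simp [density]
  | full => simp [density]
  | node l r hl hr => simp only [density]; linarith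

theorem density_le_one : T.density ≤ 1 := by
  induction T with
  | empty => simp [density]
  | full => simp [density]
  | node l r hl hr => simp only [density]; linarith

theorem enlarge_of_density_gt {T : DyadicTree} (h : 1 / 4 < T.density) : T.enlarge = full := by
  cases T with
  | empty => norm_num [density] at h
  | full => rfl
  | node l r => rw [enlarge, if_pos h]

theorem enlarge_node_of_density_le {l r : DyadicTree} (h : (node l r).density ≤ 1 / 4) :
    (node l r).enlarge = node l.enlarge r.enlarge := by
  rw [enlarge, if_neg h.not_gt]

theorem density_le_density_enlarge : T.density ≤ T.enlarge.density := by
  induction T with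
  | empty => rfl
  | full => rfl
  | node l r hl hr =>
    rcases lt_or_ge (1 / 4) (node l r).density with hdense | hsparse
    · rw [enlarge_of_density_gt hdense]
      exact density_le_one _
    · rw [enlarge_node_of_density_le hsparse]
      simp only [density]
      linarith

theorem density_enlarge_le : T.enlarge.density ≤ 4 * T.density := by
  induction T with
  | empty => simp [enlarge, density]
  | full => norm_num [enlarge, density]
  | node l r hl hr =>
    rcases lt_or_ge (1 / 4) (node l r).density with hdense | hsparse
    · rw [enlarge_of_density_gt hdense]
      simp only [density] at hdense ⊢
      linarith
    · rw [enlarge_node_of_density_le hsparse]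
      simp only [density]
      linarith

theorem density_iterate_enlarge_le (k : ℕ) :
    (enlarge^[k] T).density ≤ 4 ^ k * T.density := by
  induction k with
  | zero => simp
  | succ k ih =>
    rw [Function.iterate_succ_apply', pow_succ]
    linarith [density_enlarge_le (enlarge^[k] T)]

theorem monotone_density_iterate_enlarge : Monotone fun k => (enlarge^[k] T).density := by
  refine monotone_nat_of_le_succ fun k => ?_
  rw [Function.iterate_succ_apply']
  exact density_le_density_enlarge _

theorem iterate_enlarge_full (k : ℕ) : enlarge^[k] full = full :=
  Function.iterate_fixed rfl k

theorem iterate_enlarge_node {l r : DyadicTree} {k : ℕ}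
    (h : ∀ i < k, (enlarge^[i] (node l r)).density ≤ 1 / 4) :
    enlarge^[k] (node l r) = node (enlarge^[k] l) (enlarge^[k] r) := by
  induction k with
  | zero => rfl
  | succ k ih =>
    have hk := ih fun i hi => h i (hi.trans k.lt_succ_self)
    have hsparse := h k k.lt_succ_self
    rw [hk] at hsparse
    simp only [Function.iterate_succ_apply', hk, enlarge_node_of_density_le hsparse]

end Density

section ToSet

variable (T : DyadicTree) {a b : ℝ}

theorem toSet_subset (h : a ≤ b) : T.toSet a b ⊆ Ioc a b := by
  induction T generalizing a b with
  | empty => exact empty_subset _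
  | full => exact subset_rfl
  | node l r hl hr =>
    refine union_subset ((hl (by linarith)).trans ?_) ((hr (by linarith)).trans ?_)
    · exact Ioc_subset_Ioc le_rfl (by linarith)
    · exact Ioc_subset_Ioc (by linarith) le_rfl

theorem measurableSet_toSet : MeasurableSet (T.toSet a b) := by
  induction T generalizing a b with
  | empty => exact MeasurableSet.empty
  | full => exact measurableSet_Ioc
  | node l r hl hr => exact hl.union hr

theorem measure_toSet_node (μ : Measure ℝ) (l r : DyadicTree) (h : a ≤ b) :
    μ ((node l r).toSet a b) =
      μ (l.toSet a ((a + b) / 2)) + μ (r.toSet ((a + b) / 2) b) := by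
  refine measure_union ?_ r.measurableSet_toSet
  exact (Ioc_disjoint_Ioc_of_le le_rfl).mono (toSet_subset l (by linarith))
    (toSet_subset r (by linarith))

theorem volume_toSet (h : a ≤ b) :
    volume (T.toSet a b) = ENNReal.ofReal T.density * volume (Ioc a b) := by
  induction T generalizing a b with
  | empty => simp [toSet, density]
  | full => simp [toSet, density]
  | node l r hl hr =>
    have hhalf : ENNReal.ofReal ((a + b) / 2 - a) = ENNReal.ofReal (b - (a + b) / 2) := by
      ring_nf
    rw [measure_toSet_node _ _ _ h, hl (by linarith), hr (by linarith), Real.volume_Ioc,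
      Real.volume_Ioc, Real.volume_Ioc, hhalf, ← add_mul,
      ← ENNReal.ofReal_add l.density_nonneg r.density_nonneg,
      ← ENNReal.ofReal_mul (add_nonneg l.density_nonneg r.density_nonneg),
      ← ENNReal.ofReal_mul (node l r).density_nonneg]
    congr 1
    simp only [density]
    ring

theorem toSet_subset_toSet_enlarge (h : a ≤ b) : T.toSet a b ⊆ T.enlarge.toSet a b := by
  induction T generalizing a b with
  | empty => exact subset_rfl
  | full => exact subset_rfl
  | node l r hl hr =>
    rcases lt_or_ge (1 / 4) (node l r).density with hdense | hsparse
    · rw [enlarge_of_density_gt hdense]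
      exact toSet_subset _ h
    · rw [enlarge_node_of_density_le hsparse]
      exact union_subset_union (hl (by linarith)) (hr (by linarith))

theorem toSet_subset_toSet_iterate_enlarge (h : a ≤ b) (k : ℕ) :
    T.toSet a b ⊆ (enlarge^[k] T).toSet a b := by
  induction k with
  | zero => exact subset_rfl
  | succ k ih =>
    rw [Function.iterate_succ_apply']
    exact ih.trans (toSet_subset_toSet_enlarge _ h)

end ToSet

section InnerApprox

open Classical in
/-- The tree of depth `m` encoding the dyadic subintervals of `(a, b]` of generation `m` that are
contained in `U`. These approximate an open set from inside. -/
noncomputable def innerApprox (U : Set ℝ) : ℕ → ℝ → ℝ → DyadicTree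
  | 0, a, b => if Ioc a b ⊆ U then full else empty
  | m + 1, a, b => node (innerApprox U m a ((a + b) / 2)) (innerApprox U m ((a + b) / 2) b)

variable {U : Set ℝ} {a b : ℝ}

theorem toSet_innerApprox_subset (U : Set ℝ) (m : ℕ) (a b : ℝ) :
    (innerApprox U m a b).toSet a b ⊆ U := by
  induction m generalizing a b with
  | zero =>
    rw [innerApprox]
    split_ifs with h
    · exact h
    · exact empty_subset _
  | succ m ih => exact union_subset (ih _ _) (ih _ _)

theorem toSet_innerApprox_of_subset (m : ℕ) (hab : a ≤ b) (h : Ioc a b ⊆ U) :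
    (innerApprox U m a b).toSet a b = Ioc a b := by
  induction m generalizing a b with
  | zero => rw [innerApprox, if_pos h, toSet]
  | succ m ih =>
    rw [innerApprox, toSet, ih (by linarith) ((Ioc_subset_Ioc le_rfl (by linarith)).trans h),
      ih (by linarith) ((Ioc_subset_Ioc (by linarith) le_rfl).trans h),
      Ioc_union_Ioc_eq_Ioc (by linarith) (by linarith)]

theorem monotone_toSet_innerApprox (U : Set ℝ) (hab : a ≤ b) :
    Monotone fun m => (innerApprox U m a b).toSet a b := by
  refine monotone_nat_of_le_succ fun m => ?_
  induction m generalizing a b with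
  | zero =>
    by_cases h : Ioc a b ⊆ U
    · rw [toSet_innerApprox_of_subset _ hab h, toSet_innerApprox_of_subset _ hab h]
    · rw [innerApprox, if_neg h]
      exact empty_subset _
  | succ m ih => exact union_subset_union (ih (by linarith)) (ih (by linarith))

theorem mem_toSet_innerApprox {x ε : ℝ} (hU : Metric.ball x ε ⊆ U) (m : ℕ) (hx : x ∈ Ioc a b)
    (hm : b - a < 2 ^ m * ε) : x ∈ (innerApprox U m a b).toSet a b := by
  induction m generalizing a b with
  | zero =>
    rw [toSet_innerApprox_of_subset _ (hx.1.le.trans hx.2)]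
    · exact hx
    · refine fun y hy => hU ?_
      rw [Metric.mem_ball, Real.dist_eq, abs_lt]
      constructor <;> linarith [hx.1, hx.2, hy.1, hy.2]
  | succ m ih =>
    rw [pow_succ] at hm
    rcases le_or_gt x ((a + b) / 2) with hleft | hright
    · exact Or.inl (ih ⟨hx.1, hleft⟩ (by linarith))
    · exact Or.inr (ih ⟨hright, hx.2⟩ (by linarith))

theorem iUnion_toSet_innerApprox (hU : IsOpen U) (hab : a ≤ b) :
    ⋃ m, (innerApprox U m a b).toSet a b = U ∩ Ioc a b := by
  refine subset_antisymm (iUnion_subset fun m =>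
    subset_inter (toSet_innerApprox_subset _ _ _ _) (toSet_subset _ hab)) ?_
  rintro x ⟨hxU, hx⟩
  obtain ⟨ε, hε, hball⟩ := Metric.isOpen_iff.1 hU x hxU
  obtain ⟨m, hm⟩ := pow_unbounded_of_one_lt ((b - a) / ε) one_lt_two
  exact mem_iUnion.2 ⟨m, mem_toSet_innerApprox hball m hx ((div_lt_iff₀ hε).1 hm)⟩

end InnerApprox

end DyadicTree

/-- On each subinterval of `(a, b]`, the density of `μ` with respect to Lebesgue measure is at least
the mean of `ν`. This is what is used of a maximal function: `ν = v dx` and `μ = M(v 1_{(a, b]}) dx`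
is the main example. -/
def DominatesMeans (μ ν : Measure ℝ) (a b : ℝ) : Prop :=
  ∀ ⦃x y⦄, a ≤ x → x < y → y ≤ b → ∀ S ⊆ Ioc x y, MeasurableSet S →
    ν (Ioc x y) / volume (Ioc x y) * volume S ≤ μ S

namespace DominatesMeans

variable {μ ν : Measure ℝ} {a b : ℝ}

theorem mono {x y : ℝ} (h : DominatesMeans μ ν a b) (hx : a ≤ x) (hy : y ≤ b) :
    DominatesMeans μ ν x y :=
  fun _ _ hu huv hv => h (hx.trans hu) huv (hv.trans hy)

theorem mul_measure_Ioc_le (h : DominatesMeans μ ν a b) (hab : a < b) {c : ℝ≥0∞} {S : Set ℝ}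
    (hSab : S ⊆ Ioc a b) (hS : MeasurableSet S) (hc : c * volume (Ioc a b) ≤ volume S) :
    c * ν (Ioc a b) ≤ μ S := by
  have hpos : volume (Ioc a b) ≠ 0 := by simpa using hab
  calc c * ν (Ioc a b) = ν (Ioc a b) / volume (Ioc a b) * (c * volume (Ioc a b)) := by
        rw [mul_left_comm, ENNReal.div_mul_cancel hpos measure_Ioc_lt_top.ne]
    _ ≤ ν (Ioc a b) / volume (Ioc a b) * volume S := by gcongr
    _ ≤ μ S := h le_rfl hab le_rfl S hSab hS

theorem measure_Ioc_le (h : DominatesMeans μ ν a b) (hab : a < b) : ν (Ioc a b) ≤ μ (Ioc a b) := by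
  simpa using h.mul_measure_Ioc_le hab subset_rfl measurableSet_Ioc (one_mul _).le

theorem measure_add_half_measure_Ioc_le (h : DominatesMeans μ ν a b) (hab : a < b) {S : Set ℝ}
    (hSab : S ⊆ Ioc a b) (hS : MeasurableSet S) (hvol : volume S ≤ 2⁻¹ * volume (Ioc a b)) :
    μ S + 2⁻¹ * ν (Ioc a b) ≤ μ (Ioc a b) := by
  have hStop : volume S ≠ ∞ := measure_ne_top_of_subset hSab measure_Ioc_lt_top.ne
  have hcompl : 2⁻¹ * volume (Ioc a b) ≤ volume (Ioc a b \ S) := by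
    rw [measure_sdiff hSab hS.nullMeasurableSet hStop]
    refine ENNReal.le_sub_of_add_le_right hStop ?_
    calc 2⁻¹ * volume (Ioc a b) + volume S
        ≤ 2⁻¹ * volume (Ioc a b) + 2⁻¹ * volume (Ioc a b) := by gcongr
      _ = volume (Ioc a b) := by rw [← add_mul, ENNReal.inv_two_add_inv_two, one_mul]
  calc μ S + 2⁻¹ * ν (Ioc a b) ≤ μ S + μ (Ioc a b \ S) := by
        gcongr
        exact h.mul_measure_Ioc_le hab sdiff_subset (measurableSet_Ioc.diff hS) hcompl
    _ = μ (Ioc a b) := by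
        rw [measure_add_sdiff hS.nullMeasurableSet, union_eq_right.2 hSab]

open DyadicTree

theorem measure_toSet_add_half_le (h : DominatesMeans μ ν a b) (hab : a < b) {T : DyadicTree}
    (hT : T.density ≤ 1 / 2) :
    μ (T.toSet a b) + 2⁻¹ * ν (T.enlarge.toSet a b) ≤ μ (T.enlarge.toSet a b) := by
  induction T generalizing a b with
  | empty => simp [toSet, enlarge]
  | full => norm_num [density] at hT
  | node l r hl hr =>
    rcases lt_or_ge (1 / 4) (node l r).density with hdense | hsparse
    · rw [enlarge_of_density_gt hdense]
      refine h.measure_add_half_measure_Ioc_le hab (toSet_subset _ hab.le)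
        (measurableSet_toSet _) ?_
      rw [volume_toSet _ hab.le]
      gcongr
      simpa using ENNReal.ofReal_le_ofReal hT
    · rw [enlarge_node_of_density_le hsparse, measure_toSet_node _ _ _ hab.le,
        measure_toSet_node _ _ _ hab.le, measure_toSet_node _ _ _ hab.le, mul_add,
        add_add_add_comm]
      simp only [density] at hsparse
      have hl₀ := l.density_nonneg
      have hr₀ := r.density_nonneg
      exact add_le_add
        (hl (h.mono le_rfl (by linarith)) (by linarith) (by linarith))
        (hr (h.mono (by linarith) le_rfl) (by linarith) (by linarith))

theorem nsmul_half_measure_toSet_le (h : DominatesMeans μ ν a b) (hab : a < b) (T : DyadicTree)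
    (k : ℕ) (hT : ∀ i < k, (enlarge^[i] T).density ≤ 1 / 2) :
    k * (2⁻¹ * ν (T.toSet a b)) ≤ μ ((enlarge^[k] T).toSet a b) := by
  induction k with
  | zero => simp
  | succ k ih =>
    calc ((k + 1 : ℕ) : ℝ≥0∞) * (2⁻¹ * ν (T.toSet a b))
        = k * (2⁻¹ * ν (T.toSet a b)) + 2⁻¹ * ν (T.toSet a b) := by
          push_cast
          ring
      _ ≤ μ ((enlarge^[k] T).toSet a b) + 2⁻¹ * ν ((enlarge^[k + 1] T).toSet a b) := by
          gcongr
          · exact ih fun i hi => hT i (hi.trans k.lt_succ_self)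
          · exact toSet_subset_toSet_iterate_enlarge _ hab.le _
      _ ≤ μ ((enlarge^[k + 1] T).toSet a b) := by
          rw [Function.iterate_succ_apply']
          exact h.measure_toSet_add_half_le hab (hT k k.lt_succ_self)

end DominatesMeans

/-- The Fujii-Wilson condition with constant `A` on the subintervals of `(a, b]`, for the measure
`ν`, with the maximal function replaced by an unspecified measure that dominates the means of
`ν`. -/
def FujiiWilsonOn (ν : Measure ℝ) (A : ℝ≥0) (a b : ℝ) : Prop :=
  ∀ ⦃x y⦄, a ≤ x → x < y → y ≤ b →
    ∃ μ : Measure ℝ, DominatesMeans μ ν x y ∧ μ (Ioc x y) ≤ A * ν (Ioc x y)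

namespace FujiiWilsonOn

open DyadicTree

variable {ν : Measure ℝ} {A : ℝ≥0} {a b : ℝ}

theorem mono {x y : ℝ} (H : FujiiWilsonOn ν A a b) (hx : a ≤ x) (hy : y ≤ b) :
    FujiiWilsonOn ν A x y :=
  fun _ _ hu huv hv => H (hx.trans hu) huv (hv.trans hy)

theorem one_le (H : FujiiWilsonOn ν A a b) (hab : a < b) (hν₀ : ν (Ioc a b) ≠ 0)
    (hν : ν (Ioc a b) ≠ ∞) : 1 ≤ A := by
  obtain ⟨μ, hμ, hμA⟩ := H le_rfl hab le_rfl
  have hle : 1 * ν (Ioc a b) ≤ A * ν (Ioc a b) := by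
    simpa using (hμ.measure_Ioc_le hab).trans hμA
  exact_mod_cast (ENNReal.mul_le_mul_iff_left hν₀ hν).1 hle

/- The induction descends to the subintervals on which the `k`-th enlargement has density between
`1 / 4` and `1 / 2`: there the next enlargement is the whole subinterval, to which the Fujii-Wilson
condition applies. -/
theorem nsmul_half_measure_toSet_le (H : FujiiWilsonOn ν A a b) (hab : a < b) (k : ℕ)
    {T : DyadicTree} (hT : (enlarge^[k] T).density ≤ 1 / 2) :
    (k + 1 : ℕ) * (2⁻¹ * ν (T.toSet a b)) ≤ A * ν ((enlarge^[k + 1] T).toSet a b) := by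
  induction T generalizing a b with
  | empty => simp [toSet]
  | full =>
    rw [iterate_enlarge_full] at hT
    norm_num [density] at hT
  | node l r hl hr =>
    rcases lt_or_ge (1 / 4) (enlarge^[k] (node l r)).density with hdense | hsparse
    · obtain ⟨μ, hμ, hμA⟩ := H le_rfl hab le_rfl
      have hsum := hμ.nsmul_half_measure_toSet_le hab (node l r) (k + 1) fun i hi =>
        (monotone_density_iterate_enlarge _ (Nat.lt_succ_iff.1 hi)).trans hT
      rw [Function.iterate_succ_apply', enlarge_of_density_gt hdense] at hsum ⊢
      exact hsum.trans hμA
    · have hsparse' : ∀ i ≤ k, (enlarge^[i] (node l r)).density ≤ 1 / 4 := fun i hi =>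
        (monotone_density_iterate_enlarge _ hi).trans hsparse
      rw [iterate_enlarge_node fun i hi => hsparse' i hi.le] at hsparse
      simp only [density] at hsparse
      have hl₀ := (enlarge^[k] l).density_nonneg
      have hr₀ := (enlarge^[k] r).density_nonneg
      rw [iterate_enlarge_node fun i hi => hsparse' i (Nat.lt_succ_iff.1 hi),
        measure_toSet_node _ _ _ hab.le, measure_toSet_node _ _ _ hab.le, mul_add, mul_add, mul_add]
      exact add_le_add
        (hl (H.mono le_rfl (by linarith)) (by linarith) (by linarith))
        (hr (H.mono (by linarith) le_rfl) (by linarith) (by linarith))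

theorem two_mul_measure_toSet_le (H : FujiiWilsonOn ν A a b) (hA : 0 < A) (hab : a < b) {N : ℕ}
    (hN : 4 * A ≤ N) {T : DyadicTree} (hT : 4 ^ N * (2 * T.density) ≤ 1) :
    2 * ν (T.toSet a b) ≤ ν ((enlarge^[N] T).toSet a b) := by
  obtain ⟨k, rfl⟩ : ∃ k, N = k + 1 := Nat.exists_eq_succ_of_ne_zero <| by
    rintro rfl
    simp [hA.ne'] at hN
  have hk : (enlarge^[k] T).density ≤ 1 / 2 := by
    have hd := density_iterate_enlarge_le T k
    have hpos := mul_nonneg (pow_nonneg zero_le_four k) T.density_nonneg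
    rw [pow_succ] at hT
    linarith
  refine (ENNReal.mul_le_mul_iff_right (ENNReal.coe_ne_zero.2 hA.ne') ENNReal.coe_ne_top).1 ?_
  calc A * (2 * ν (T.toSet a b)) = (4 * A : ℝ≥0) * (2⁻¹ * ν (T.toSet a b)) := by
        have hfour : (4 : ℝ≥0∞) * 2⁻¹ = 2 := by
          rw [← two_add_two_eq_four, ← two_mul, ENNReal.mul_inv_cancel_right two_ne_zero
            ENNReal.ofNat_ne_top]
        push_cast
        rw [mul_mul_mul_comm, hfour, mul_left_comm]
    _ ≤ (k + 1 : ℕ) * (2⁻¹ * ν (T.toSet a b)) := by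
        gcongr
        exact_mod_cast hN
    _ ≤ A * ν ((enlarge^[k + 1] T).toSet a b) := H.nsmul_half_measure_toSet_le hab k hk

theorem two_pow_mul_measure_toSet_le (H : FujiiWilsonOn ν A a b) (hA : 0 < A) (hab : a < b)
    {N : ℕ} (hN : 4 * A ≤ N) (j : ℕ) {T : DyadicTree}
    (hT : (4 ^ N) ^ j * (2 * T.density) ≤ 1) : 2 ^ j * ν (T.toSet a b) ≤ ν (Ioc a b) := by
  induction j generalizing T with
  | zero => simpa using measure_mono (T.toSet_subset hab.le)
  | succ j ih =>
    have hd := T.density_nonneg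
    have hround : 4 ^ N * (2 * T.density) ≤ 1 := by
      refine le_trans ?_ hT
      rw [pow_succ _ j, mul_assoc]
      exact le_mul_of_one_le_left (by positivity) (one_le_pow₀ (one_le_pow₀ (by norm_num)))
    have hrest : (4 ^ N) ^ j * (2 * (enlarge^[N] T).density) ≤ 1 := by
      refine le_trans ?_ hT
      rw [pow_succ _ j, mul_assoc]
      refine mul_le_mul_of_nonneg_left ?_ (by positivity)
      rw [mul_left_comm]
      gcongr
      exact density_iterate_enlarge_le T N
    calc 2 ^ (j + 1) * ν (T.toSet a b) = 2 ^ j * (2 * ν (T.toSet a b)) := by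
          rw [pow_succ, mul_assoc]
      _ ≤ 2 ^ j * ν ((enlarge^[N] T).toSet a b) := by
          gcongr
          exact H.two_mul_measure_toSet_le hA hab hN hround
      _ ≤ ν (Ioc a b) := ih hrest

theorem two_pow_mul_measure_le (H : FujiiWilsonOn ν A a b) (hA : 0 < A) (hab : a < b) {N : ℕ}
    (hN : 4 * A ≤ N) (j : ℕ) {E : Set ℝ} (hE : E ⊆ Ioc a b)
    (hj : (4 ^ N) ^ j * (2 * (volume E / volume (Ioc a b))) < 1) :
    2 ^ j * ν E ≤ ν (Ioc a b) := by
  set B : ℝ≥0∞ := (4 ^ N) ^ j * 2 with hB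
  have hB₀ : B ≠ 0 := by simp [hB]
  have hBtop : B ≠ ∞ := by finiteness
  have hvol₀ : volume (Ioc a b) ≠ 0 := by simpa using hab
  have hvol : volume (Ioc a b) ≠ ∞ := measure_Ioc_lt_top.ne
  have hElt : volume E < B⁻¹ * volume (Ioc a b) := by
    rwa [← ENNReal.div_lt_iff (.inl hvol₀) (.inl hvol), ← one_div,
      ENNReal.lt_div_iff_mul_lt (.inl hB₀) (.inl hBtop), mul_comm, hB, mul_assoc]
  obtain ⟨U, hEU, hU, hUlt⟩ := Set.exists_isOpen_lt_of_lt E _ hElt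
  have hdensity : ∀ m, (4 ^ N) ^ j * (2 * (innerApprox U m a b).density) ≤ 1 := by
    intro m
    have hle := (measure_mono (toSet_innerApprox_subset U m a b)).trans hUlt.le
    rw [volume_toSet _ hab.le, ENNReal.mul_le_mul_iff_left hvol₀ hvol,
      ← one_div, ENNReal.le_div_iff_mul_le (.inl hB₀) (.inl hBtop), mul_comm] at hle
    rw [← mul_assoc, ← ENNReal.ofReal_le_one, ENNReal.ofReal_mul (by positivity)]
    convert hle
    rw [hB, ENNReal.ofReal_mul (by positivity), ENNReal.ofReal_pow (by positivity),
      ENNReal.ofReal_pow (by positivity), ENNReal.ofReal_ofNat, ENNReal.ofReal_ofNat]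
  calc 2 ^ j * ν E ≤ 2 ^ j * ν (⋃ m, (innerApprox U m a b).toSet a b) := by
        rw [iUnion_toSet_innerApprox hU hab.le]
        gcongr
        exact subset_inter hEU hE
    _ = ⨆ m, 2 ^ j * ν ((innerApprox U m a b).toSet a b) := by
        rw [(monotone_toSet_innerApprox U hab.le).measure_iUnion, ENNReal.mul_iSup]
    _ ≤ ν (Ioc a b) :=
        iSup_le fun m => H.two_pow_mul_measure_toSet_le hA hab hN j (hdensity m)

end FujiiWilsonOn

theorem le_two_mul_rpow_mul_of_forall_pow_mul_lt {B x p q : ℝ≥0∞} {δ : ℝ} (hδ : 0 ≤ δ) (hB : 1 < B)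
    (hBδ : B ^ δ ≤ 2) (hx : x ≠ 0) (hpq : p ≤ q) (h : ∀ j : ℕ, B ^ j * x < 1 → 2 ^ j * p ≤ q) :
    p ≤ 2 * x ^ δ * q := by
  classical
  have hlarge : ∃ k : ℕ, 1 ≤ B ^ k * x := by
    have hlim := ENNReal.Tendsto.mul_const
      (ENNReal.tendsto_pow_atTop_nhds_top_iff.2 hB) (.inl ENNReal.top_ne_zero) (b := x)
    rw [ENNReal.top_mul hx] at hlim
    exact (hlim.eventually_const_le ENNReal.one_lt_top).exists
  set k := Nat.find hlarge
  have hpow : 2 ^ k * p ≤ 2 * q := by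
    rcases Nat.eq_zero_or_pos k with hk₀ | hk₀
    · rw [hk₀, pow_zero, one_mul]
      exact hpq.trans (le_mul_of_one_le_left zero_le one_le_two)
    · obtain ⟨j, hj⟩ : ∃ j, k = j + 1 := Nat.exists_eq_succ_of_ne_zero hk₀.ne'
      have hjlt : B ^ j * x < 1 := not_le.1 (Nat.find_min hlarge (by omega))
      rw [hj, pow_succ', mul_assoc]
      gcongr
      exact h j hjlt
  have hone : 1 ≤ 2 ^ k * x ^ δ :=
    calc (1 : ℝ≥0∞) = 1 ^ δ := (ENNReal.one_rpow δ).symm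
      _ ≤ (B ^ k * x) ^ δ := ENNReal.rpow_le_rpow (Nat.find_spec hlarge) hδ
      _ = (B ^ δ) ^ k * x ^ δ := by
        rw [ENNReal.mul_rpow_of_nonneg _ _ hδ, ← ENNReal.rpow_natCast, ← ENNReal.rpow_mul,
          mul_comm _ δ, ENNReal.rpow_mul, ENNReal.rpow_natCast]
      _ ≤ 2 ^ k * x ^ δ := by gcongr
  calc p ≤ 2 ^ k * x ^ δ * p := le_mul_of_one_le_left zero_le hone
    _ = x ^ δ * (2 ^ k * p) := by ring
    _ ≤ x ^ δ * (2 * q) := by gcongr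
    _ = 2 * x ^ δ * q := by ring

theorem FujiiWilsonOn.measure_le {ν : Measure ℝ} {A : ℝ≥0} {a b : ℝ} (H : FujiiWilsonOn ν A a b)
    (hA : 1 ≤ A) (hab : a < b) {E : Set ℝ} (hE : E ⊆ Ioc a b) (hE₀ : volume E ≠ 0) :
    ν E ≤ 4 * (volume E / volume (Ioc a b)) ^ (10 * A : ℝ)⁻¹ * ν (Ioc a b) := by
  set δ : ℝ := (10 * A : ℝ)⁻¹ with hδ
  set r := volume E / volume (Ioc a b)
  have hA' : (1 : ℝ) ≤ A := by exact_mod_cast hA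
  have hδ₀ : 0 ≤ δ := by positivity
  have hδ₁ : δ ≤ 1 := inv_le_one_of_one_le₀ (by linarith [hA'])
  have hr₀ : r ≠ 0 := (ENNReal.div_pos hE₀ measure_Ioc_lt_top.ne).ne'
  obtain ⟨N, hN, hN'⟩ : ∃ N : ℕ, 4 * A ≤ N ∧ (N : ℝ) ≤ 5 * A :=
    ⟨⌈4 * A⌉₊, Nat.le_ceil _, by
      have hceil : (⌈4 * A⌉₊ : ℝ) < 4 * A + 1 := by
        exact_mod_cast Nat.ceil_lt_add_one (zero_le (a := 4 * A))
      linarith⟩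
  have hbase : ((4 : ℝ≥0∞) ^ N) ^ δ ≤ 2 := by
    have hfour : (4 : ℝ≥0∞) ^ N = 2 ^ (2 * N : ℝ) := by
      rw [ENNReal.rpow_mul, ENNReal.rpow_natCast, ENNReal.rpow_two]
      norm_num
    rw [hfour, ← ENNReal.rpow_mul]
    refine (ENNReal.rpow_le_rpow_of_exponent_le one_le_two ?_).trans_eq (ENNReal.rpow_one 2)
    rw [hδ, ← div_eq_mul_inv, div_le_one (by positivity)]
    linarith
  have hN₀ : N ≠ 0 := by
    rintro rfl
    simp [(zero_lt_one.trans_le hA).ne'] at hN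
  calc ν E ≤ 2 * (2 * r) ^ δ * ν (Ioc a b) :=
        le_two_mul_rpow_mul_of_forall_pow_mul_lt hδ₀ (one_lt_pow₀ (by norm_num) hN₀) hbase
          (mul_ne_zero two_ne_zero hr₀) (measure_mono hE) fun j hj =>
            H.two_pow_mul_measure_le (zero_lt_one.trans_le hA) hab hN j hE hj
    _ ≤ 2 * (2 * r ^ δ) * ν (Ioc a b) := by
        rw [ENNReal.mul_rpow_of_nonneg _ _ hδ₀]
        gcongr
        simpa using ENNReal.rpow_le_rpow_of_exponent_le one_le_two hδ₁
    _ = 4 * r ^ δ * ν (Ioc a b) := by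
        rw [← mul_assoc, ← two_add_two_eq_four, two_mul 2]

section MaximalFunction

variable {v : ℝ → ℝ}

theorem setLIntegral_Ioo_eq_Ioc (f : ℝ → ℝ≥0∞) (a b : ℝ) :
    ∫⁻ x in Ioo a b, f x = ∫⁻ x in Ioc a b, f x :=
  setLIntegral_congr Ioo_ae_eq_Ioc

theorem ofReal_abs_indicator (hv : ∀ t, 0 ≤ v t) (s : Set ℝ) :
    (fun t => ENNReal.ofReal |s.indicator v t|) = s.indicator fun t => ENNReal.ofReal (v t) := by
  ext t
  by_cases h : t ∈ s <;> simp [h, abs_of_nonneg (hv t)]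

theorem maximalFunction_indicator_eq_zero (hv : ∀ t, 0 ≤ v t) {s : Set ℝ} (hs : MeasurableSet s)
    (h : ∫⁻ t in s, ENNReal.ofReal (v t) = 0) (x : ℝ) :
    maximalFunction (s.indicator v) x = 0 := by
  simp only [maximalFunction, ENNReal.iSup_eq_zero, ofReal_abs_indicator hv,
    setLIntegral_indicator hs]
  intro c d _
  have hzero : ∫⁻ t in s ∩ Ioo c d, ENNReal.ofReal (v t) = 0 :=
    nonpos_iff_eq_zero.1 ((lintegral_mono_set inter_subset_left).trans_eq h)
  rw [hzero, ENNReal.zero_div]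

theorem setLIntegral_maximalFunction_le (hv : ∀ t, 0 ≤ v t) {A : ℝ≥0∞} (hA₀ : A ≠ 0)
    (hA : ainftyConst v ≤ A) {a b : ℝ} (hab : a < b) :
    ∫⁻ x in Ioo a b, maximalFunction ((Ioo a b).indicator v) x ≤
      A * ∫⁻ x in Ioo a b, ENNReal.ofReal (v x) := by
  rcases eq_or_ne (∫⁻ x in Ioo a b, ENNReal.ofReal (v x)) 0 with hzero | hzero
  · simp [maximalFunction_indicator_eq_zero hv measurableSet_Ioo hzero]
  rcases eq_or_ne (∫⁻ x in Ioo a b, ENNReal.ofReal (v x)) ∞ with htop | htop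
  · rw [htop, ENNReal.mul_top hA₀]
    exact le_top
  · rw [← ENNReal.div_le_iff hzero htop]
    refine le_trans ?_ hA
    exact le_iSup₂_of_le a b (le_iSup_of_le hab le_rfl)

theorem setLIntegral_div_volume_le_maximalFunction (hv : ∀ t, 0 ≤ v t) {s : Set ℝ} {x y t : ℝ}
    (hs : Ioo x y ⊆ s) (ht : t ∈ Ioo x y) :
    (∫⁻ u in Ioo x y, ENNReal.ofReal (v u)) / volume (Ioo x y) ≤
      maximalFunction (s.indicator v) t := by
  refine le_iSup₂_of_le x y (le_iSup_of_le ht ?_)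
  rw [Real.volume_Ioo, setLIntegral_congr_fun measurableSet_Ioo fun u hu => ?_]
  simp only [indicator_of_mem (hs hu), abs_of_nonneg (hv u)]

theorem dominatesMeans_maximalFunction (hv : ∀ t, 0 ≤ v t) (a b : ℝ) :
    DominatesMeans (volume.withDensity (maximalFunction ((Ioo a b).indicator v)))
      (volume.withDensity fun x => ENNReal.ofReal (v x)) a b := by
  intro x y hx _ hy S hSxy hS
  rw [withDensity_apply _ measurableSet_Ioc, withDensity_apply _ hS, ← setLIntegral_Ioo_eq_Ioc,
    ← measure_congr Ioo_ae_eq_Ioc, ← setLIntegral_const]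
  refine setLIntegral_mono_ae' hS ?_
  filter_upwards [Measure.ae_ne volume y] with t hty htS
  exact setLIntegral_div_volume_le_maximalFunction hv (Ioo_subset_Ioo hx hy)
    ⟨(hSxy htS).1, (hSxy htS).2.lt_of_ne hty⟩

theorem fujiiWilsonOn_withDensity (hv : ∀ t, 0 ≤ v t) {A : ℝ≥0} (hA₀ : 0 < A)
    (hA : ainftyConst v ≤ A) (a b : ℝ) :
    FujiiWilsonOn (volume.withDensity fun x => ENNReal.ofReal (v x)) A a b := by
  intro x y _ hxy _
  refine ⟨_, dominatesMeans_maximalFunction hv x y, ?_⟩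
  rw [withDensity_apply _ measurableSet_Ioc, withDensity_apply _ measurableSet_Ioc,
    ← setLIntegral_Ioo_eq_Ioc, ← setLIntegral_Ioo_eq_Ioc]
  exact setLIntegral_maximalFunction_le hv (ENNReal.coe_ne_zero.2 hA₀.ne') hA hxy

end MaximalFunction

theorem hasAinftyBoundOn_Icc_of_ainftyConst_le {v : ℝ → ℝ} (hv : ∀ t, 0 ≤ v t) {A : ℝ≥0}
    (hA₀ : 0 < A) (hA : ainftyConst v ≤ A) {a b : ℝ} (hab : a < b) :
    HasAinftyBoundOn volume 4 (10 * A) (fun t => ENNReal.ofReal (v t)) (Icc a b) := by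
  refine HasAinftyBoundOn.congr_set ?_ measurableSet_Ioc Ioc_ae_eq_Icc
  rcases eq_or_ne (∫⁻ t in Ioc a b, ENNReal.ofReal (v t)) 0 with hzero | hzero
  · exact .of_lintegral_eq_zero hzero
  rcases eq_or_ne (∫⁻ t in Ioc a b, ENNReal.ofReal (v t)) ∞ with htop | htop
  · exact .of_lintegral_eq_top four_ne_zero (by positivity) measure_Ioc_lt_top.ne htop
  intro E hE hEab
  rcases eq_or_ne (volume E) 0 with hE₀ | hE₀
  · simp [setLIntegral_measure_zero _ _ hE₀]
  have H := fujiiWilsonOn_withDensity hv hA₀ hA a b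
  rw [← withDensity_apply _ measurableSet_Ioc] at hzero htop
  rw [← withDensity_apply _ hE, ← withDensity_apply _ measurableSet_Ioc]
  exact H.measure_le (H.one_le hab hzero htop) hab hEab hE₀

/-- The identification of `ℝ × ℝⁿ` with `ℝⁿ⁺¹` that prepends a coordinate; it reduces estimates on
boxes to estimates on products. -/
def consMeasurableEquiv (n : ℕ) : ℝ × (Fin n → ℝ) ≃ᵐ (Fin (n + 1) → ℝ) :=
  (MeasurableEquiv.piFinSuccAbove (fun _ => ℝ) 0).symm

theorem consMeasurableEquiv_apply {n : ℕ} (t : ℝ) (x : Fin n → ℝ) :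
    consMeasurableEquiv n (t, x) = Fin.cons t x :=
  Fin.insertNth_zero' t x

theorem measurePreserving_consMeasurableEquiv (n : ℕ) :
    MeasurePreserving (consMeasurableEquiv n) (volume.prod volume) volume :=
  (volume_preserving_piFinSuccAbove (fun _ : Fin (n + 1) => ℝ) 0).symm

theorem preimage_consMeasurableEquiv_Icc {n : ℕ} (a b : Fin (n + 1) → ℝ) :
    consMeasurableEquiv n ⁻¹' Icc a b = Icc (a 0) (b 0) ×ˢ Icc (Fin.tail a) (Fin.tail b) := by
  ext ⟨t, x⟩
  simp only [mem_preimage, consMeasurableEquiv_apply, mem_prod, mem_Icc, Pi.le_def,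
    Fin.forall_fin_succ, Fin.cons_zero, Fin.cons_succ, Fin.tail]
  tauto

theorem ae_cons_of_ae_update_zero {n : ℕ} {P : (ℝ → Fin (n + 1) → ℝ) → Prop}
    (h : ∀ᵐ x : Fin (n + 1) → ℝ, P fun t => Function.update x 0 t) :
    ∀ᵐ x : Fin n → ℝ, P fun t => Fin.cons t x := by
  have hcons := (measurePreserving_consMeasurableEquiv n).quasiMeasurePreserving.ae h
  have hswap := Measure.measurePreserving_swap.quasiMeasurePreserving.ae hcons
  refine (Measure.ae_ae_of_ae_prod hswap).mono fun x hx => ?_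
  obtain ⟨s, hs⟩ := hx.exists
  simpa [consMeasurableEquiv_apply] using hs

theorem ae_ae_cons_update_of_ae_update_succ {n : ℕ} {j : Fin n}
    {P : (ℝ → Fin (n + 1) → ℝ) → Prop}
    (h : ∀ᵐ x : Fin (n + 1) → ℝ, P fun t => Function.update x j.succ t) :
    ∀ᵐ s : ℝ, ∀ᵐ x : Fin n → ℝ, P fun t => Fin.cons s (Function.update x j t) := by
  have hcons := (measurePreserving_consMeasurableEquiv n).quasiMeasurePreserving.ae h
  refine (Measure.ae_ae_of_ae_prod hcons).mono fun s hs => hs.mono fun x hx => ?_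
  simpa [consMeasurableEquiv_apply, Fin.cons_update] using hx

theorem HasAinftyBoundOn.Icc_of_update_fin_one {C : ℝ≥0} {p : ℝ} {g : (Fin 1 → ℝ) → ℝ≥0∞}
    {a b : Fin 1 → ℝ}
    (h : ∀ᵐ x, HasAinftyBoundOn volume C p (fun t => g (Function.update x 0 t))
      (Icc (a 0) (b 0))) :
    HasAinftyBoundOn volume C p g (Icc a b) := by
  obtain ⟨x, hx⟩ := h.exists
  have he := (volume_preserving_funUnique (Fin 1) ℝ).symm
  refine of_comp_measurableEquiv he ?_
  have hIcc : (MeasurableEquiv.funUnique (Fin 1) ℝ).symm ⁻¹' Icc a b = Icc (a 0) (b 0) := by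
    ext t
    simp [Pi.le_def]
  rw [hIcc]
  convert hx with t
  ext i
  simp [Subsingleton.elim i 0]

theorem HasAinftyBoundOn.Icc_of_update_succ {C K : ℝ≥0} {p q : ℝ} (hp : 0 < p) (hq : 0 < q)
    {n : ℕ} {g : (Fin (n + 1) → ℝ) → ℝ≥0∞} (hg : AEMeasurable g) {a b : Fin (n + 1) → ℝ}
    (hab : a 0 < b 0)
    (h₁ : ∀ᵐ x : Fin n → ℝ,
      HasAinftyBoundOn volume C p (fun t => g (Fin.cons t x)) (Icc (a 0) (b 0)))
    (h₂ : ∀ᵐ t : ℝ, HasAinftyBoundOn volume K q (fun x : Fin n → ℝ => g (Fin.cons t x))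
      (Icc (Fin.tail a) (Fin.tail b))) :
    HasAinftyBoundOn volume (C + K) (p + q) g (Icc a b) := by
  have he := measurePreserving_consMeasurableEquiv n
  refine of_comp_measurableEquiv he ?_
  rw [preimage_consMeasurableEquiv_Icc]
  refine HasAinftyBoundOn.prod (hg.comp_quasiMeasurePreserving he.quasiMeasurePreserving) hp hq
    (by simpa using hab) measure_Icc_lt_top.ne measurableSet_Icc measure_Icc_lt_top.ne ?_ ?_
  · simpa only [Function.comp_apply, consMeasurableEquiv_apply] using h₁
  · simpa only [Function.comp_apply, consMeasurableEquiv_apply] using h₂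

theorem HasAinftyBoundOn.Icc_of_update {C : ℝ≥0} {p : ℝ} (hp : 0 < p) {n : ℕ} (hn : 1 ≤ n)
    {g : (Fin n → ℝ) → ℝ≥0∞} (hg : AEMeasurable g) {a b : Fin n → ℝ} (hab : ∀ i, a i < b i)
    (h : ∀ j, ∀ᵐ x, HasAinftyBoundOn volume C p (fun t => g (Function.update x j t))
      (Icc (a j) (b j))) :
    HasAinftyBoundOn volume (n * C) (n * p) g (Icc a b) := by
  induction n, hn using Nat.le_induction with
  | base => simpa using Icc_of_update_fin_one (h 0)
  | succ n hn ih =>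
    have hn₀ : (0 : ℝ) < n := by exact_mod_cast hn
    have hfirst := ae_cons_of_ae_update_zero
      (P := fun φ => HasAinftyBoundOn volume C p (fun t => g (φ t)) (Icc (a 0) (b 0))) (h 0)
    have hrest : ∀ᵐ t : ℝ, ∀ j : Fin n, ∀ᵐ x : Fin n → ℝ, HasAinftyBoundOn volume C p
        (fun s => g (Fin.cons t (Function.update x j s))) (Icc (a j.succ) (b j.succ)) :=
      ae_all_iff.2 fun j => ae_ae_cons_update_of_ae_update_succ (P := fun φ =>
        HasAinftyBoundOn volume C p (fun t => g (φ t)) (Icc (a j.succ) (b j.succ))) (h j.succ)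
    have hmeas : ∀ᵐ t : ℝ, AEMeasurable fun x : Fin n → ℝ => g (Fin.cons t x) := by
      have hcomp := hg.comp_quasiMeasurePreserving
        (measurePreserving_consMeasurableEquiv n).quasiMeasurePreserving
      filter_upwards [hcomp.aestronglyMeasurable.prodMk_left] with t ht
      simpa only [Function.comp_apply, consMeasurableEquiv_apply] using ht.aemeasurable
    have htail : ∀ᵐ t : ℝ, HasAinftyBoundOn volume (n * C) (n * p)
        (fun x : Fin n → ℝ => g (Fin.cons t x)) (Icc (Fin.tail a) (Fin.tail b)) := by
      filter_upwards [hrest, hmeas] with t ht htm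
      exact ih htm (fun i => hab i.succ) ht
    convert Icc_of_update_succ hp (mul_pos hn₀ hp) hg (hab 0) hfirst htail using 1 <;>
      push_cast <;> ring

theorem slice_restrict {n : ℕ} (w : (Fin n → ℝ) → ℝ) (j : Fin n) (x : Fin n → ℝ) :
    slice w j (fun i => x i) = fun t => w (Function.update x j t) := by
  ext t
  rw [slice]
  congr 1
  ext i
  by_cases h : i = j <;> simp [h]

theorem ae_ainftyConst_update_le {n : ℕ} (w : (Fin n → ℝ) → ℝ) (j : Fin n) :
    ∀ᵐ x, ainftyConst (fun t => w (Function.update x j t)) ≤ strongAinftyConst w := by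
  have hslice : ∀ᵐ y, ainftyConst (slice w j y) ≤ strongAinftyConst w :=
    (ENNReal.ae_le_essSup _).mono fun y hy => hy.trans
      (le_iSup (fun j => essSup (fun y => ainftyConst (slice w j y)) volume) j)
  have hrestrict := Measure.quasiMeasurePreserving_fst.comp
    (volume_preserving_piEquivPiSubtypeProd (fun _ : Fin n => ℝ)
      (fun i => i ≠ j)).quasiMeasurePreserving
  filter_upwards [hrestrict.ae hslice] with x hx
  rwa [← slice_restrict]

theorem hasAinftyBoundOn_Icc_of_strongAinftyConst_le {n : ℕ} (hn : 1 ≤ n) {w : (Fin n → ℝ) → ℝ}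
    (hw₀ : ∀ x, 0 ≤ w x) (hw : AEMeasurable w) {A : ℝ≥0} (hA : strongAinftyConst w ≤ A)
    {a b : Fin n → ℝ} (hab : ∀ i, a i < b i) :
    HasAinftyBoundOn volume (n * 4) (n * (10 * A)) (fun x => ENNReal.ofReal (w x)) (Icc a b) := by
  rcases eq_zero_or_pos A with rfl | hA₀
  · have hC : (1 : ℝ≥0) ≤ n * 4 := by
      have hn' : (1 : ℝ≥0) ≤ n := by exact_mod_cast hn
      linarith
    simpa using HasAinftyBoundOn.of_exponent_zero hC
  · refine .Icc_of_update (by positivity) hn hw.ennreal_ofReal hab fun j => ?_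
    filter_upwards [ae_ainftyConst_update_le w j] with x hx
    exact hasAinftyBoundOn_Icc_of_ainftyConst_le (fun _ => hw₀ _) hA₀ (hx.trans hA) (hab j)

theorem rectangle_eq_Icc {n : ℕ} (a b : Fin n → ℝ) : rectangle a b = Icc a b := by
  ext x
  simp only [rectangle, mem_ofPred_eq, mem_Icc, Pi.le_def, forall_and]

theorem mainTheorem6 :
    ∃ c : ℝ, 0 < c ∧ ∀ n : ℕ, 1 ≤ n → ∃ Cn : ℝ, 0 < Cn ∧
      ∀ w : (Fin n → ℝ) → ℝ, IsStrongAinfty w →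
        ∀ a b : Fin n → ℝ, (∀ i, a i < b i) →
          ∀ E : Set (Fin n → ℝ), NullMeasurableSet E volume → E ⊆ rectangle a b →
            (∫ x in E, w x) ≤
              Cn * (volume.real E / volume.real (rectangle a b)) ^
                  (1 / (c * (n : ℝ) * (strongAinftyConst w).toReal)) *
                ∫ x in rectangle a b, w x := by
  refine ⟨10, by norm_num, fun n hn => ⟨n * 4, by positivity, fun w hw a b hab E hE hER => ?_⟩⟩
  rw [rectangle_eq_Icc] at hER ⊢
  have hloc := hw.isWeight.locallyIntegrable
  have hbound := hasAinftyBoundOn_Icc_of_strongAinftyConst_le hn hw.isWeight.nonneg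
    hloc.aestronglyMeasurable.aemeasurable (ENNReal.coe_toNNReal hw.const_lt_top.ne).ge hab
  have hexp : 1 / (10 * (n : ℝ) * (strongAinftyConst w).toReal) =
      (n * (10 * (strongAinftyConst w).toNNReal) : ℝ)⁻¹ := by
    rw [one_div, mul_assoc, mul_left_comm, ENNReal.coe_toNNReal_eq_toReal]
  rw [hexp]
  simpa using hbound.setIntegral_le hw.isWeight.nonneg (hloc.integrableOn_isCompact isCompact_Icc)
    (by positivity) hE hER
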